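/- Let $n\ge 1$ and let $\{A(t)\}_{t=0}^\infty$ be a stochastic chain, i.e. a sequence of row-stochastic matrices $A(t)=(a_{ij}(t))\in\mathbb R^{n\times n}$ (non-negative entries, every row summing to $1$). Suppose that the chain is - strongly aperiodic: there is a constant $\gamma>0$ with $a_{ii}(t)\ge\gamma$ for all $i\in[n]=\{1,\dots,n\}$ and all $t\ge 0$; and - approximately reciprocal: there are constants $p_0,\beta\in(0,\infty)$ such that, for all $S\subseteq[n]$ with complement $\bar S=[n]\setminus S$ and all integers $0\le t_0<t_1$, $$p_0\sum_{t=t_0}^{t_1-1}\sum_{i\in S}\sum_{j\in\bar S}a_{ij}(t)\;\le\;\sum_{t=t_0}^{t_1-1}\sum_{i\in\bar S}\sum_{j\in S}a_{ij}(t)+\beta .$$ An absolute probability sequence for the chain is a sequence $\{\pi(t)\}_{t=0}^\infty$ of vectors in $\mathbb R^n$ with non-negative entries summing to $1$ such that $\pi(t+1)^{T}A(t)=\pi(t)^{T}$ for all $t\ge 0$. The infinite flow graph of the chain is the undirected graph with vertex set $[n]$ in which distinct $i,j$ are adjacent if and only if $\sum_{t=0}^\infty\bigl(a_{ij}(t)+a_{ji}(t)\bigr)=\infty$.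 Then the chain admits a unique absolute probability sequence (that is, there is exactly one) if and only if its infinite flow graph is connected. -/

import Mathlib

namespace StochasticChain

/-- A stochastic chain: every matrix `A t` is row-stochastic. -/
def IsStochasticChain {n : ℕ} (A : ℕ → Matrix (Fin n) (Fin n) ℝ) : Prop :=
  ∀ t, A t ∈ Matrix.rowStochastic ℝ (Fin n)

/-- Strong aperiodicity: all diagonal entries are at least some `γ > 0`, uniformly in time. -/
def StronglyAperiodic {n : ℕ} (A : ℕ → Matrix (Fin n) (Fin n) ℝ) : Prop :=
  ∃ γ : ℝ, 0 < γ ∧ ∀ t i, γ ≤ A t i i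

/-- `cut M S` is the sum of the entries of `M` in the rows of `S` and the columns outside `S`,
that is, `𝟏ᵀ M_{S S̄} 𝟏`. -/
def cut {n : ℕ} (M : Matrix (Fin n) (Fin n) ℝ) (S : Finset (Fin n)) : ℝ :=
  ∑ i ∈ S, ∑ j ∈ Sᶜ, M i j

/-- Approximate reciprocity. The reverse flow `𝟏ᵀ M_{S̄ S} 𝟏` is `cut M Sᶜ`. -/
def ApproxReciprocal {n : ℕ} (A : ℕ → Matrix (Fin n) (Fin n) ℝ) : Prop :=
  ∃ p₀ β : ℝ, 0 < p₀ ∧ 0 < β ∧ ∀ (S : Finset (Fin n)) (t₀ t₁ : ℕ), t₀ < t₁ →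
    p₀ * ∑ t ∈ Finset.Ico t₀ t₁, cut (A t) S ≤ (∑ t ∈ Finset.Ico t₀ t₁, cut (A t) Sᶜ) + β

/-- An absolute probability sequence: stochastic vectors with `π(t+1)ᵀ A(t) = π(t)ᵀ`. -/
def IsAbsoluteProbabilitySequence {n : ℕ} (A : ℕ → Matrix (Fin n) (Fin n) ℝ)
    (π : ℕ → Fin n → ℝ) : Prop :=
  (∀ t, π t ∈ stdSimplex ℝ (Fin n)) ∧ ∀ t, Matrix.vecMul (π (t + 1)) (A t) = π t

/-- The infinite flow graph: `i ≠ j` are adjacent iff `∑ₜ (aᵢⱼ(t) + aⱼᵢ(t)) = ∞`, i.e. the partial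
sums tend to infinity. -/
def infiniteFlowGraph {n : ℕ} (A : ℕ → Matrix (Fin n) (Fin n) ℝ) : SimpleGraph (Fin n) where
  Adj i j := i ≠ j ∧ Filter.Tendsto
    (fun T : ℕ => ∑ t ∈ Finset.range T, (A t i j + A t j i)) Filter.atTop Filter.atTop
  symm := ⟨fun i j h => ⟨h.1.symm, by simpa only [add_comm] using h.2⟩⟩
  loopless := ⟨fun _ h => h.1 rfl⟩

end StochasticChain

/-!
An absolute probability sequence is a trajectory, run backwards in time, of a mass-conserving
dynamics: in the step from `t + 1` to `t` the fraction `aᵢⱼ(t)` of the mass at `i` moves to `j`.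
The dual dynamics `x(t+1) = A(t) x(t)` runs forward, and `π(t) ⬝ x(t)` is constant along it.

*Existence.* Backward trajectories started at later and later times `T` live in a product of
simplices, so they have a cluster point, and closed conditions on the trajectories survive in the
limit (`exists_absoluteProbabilitySequence`).

*Uniqueness forces connectedness.* If the infinite flow graph is disconnected, a component `S`
exchanges only a finite total flow with its complement, hence less than `1/4` after some time `t₀`.
Trajectories started inside `S`, respectively inside `Sᶜ`, keep there a mass of at least `3/4` down
to time `t₀`, and their limits are two different absolute probability sequences.

*Connectedness forces uniqueness.* The key point is that backward trajectories started from the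
uniform vector stay above a constant `p > 0` that does not depend on the starting time
(`exists_uniform_lower_bound`). This goes by downward induction on the cardinality of a set `S`:
as long as the mass of `S` is tiny, every vertex outside `S` carries a definite mass `e`, since
adding it to `S` gives a larger set. Over such an excursion `S` loses at most `η F` and gains at
least `e G`, where `F` and `G` are the total flows out of and into `S`; reciprocity `p₀ F ≤ G + β`
makes this a net gain once `F ≥ 2β/p₀`, and for smaller `F` strong aperiodicity bounds the loss
by the factor `exp (-F/γ)`.

With an absolute probability sequence `π ≥ p`, the energy `∑ πᵢ(t) xᵢ(t)²` decreases in each step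
by at least a constant times `∑ aᵢⱼ (xᵢ - xⱼ)²` (`energy_decrease`). If the spread of `x(t)` stayed
above `ε`, then at any time there would be a gap of length `ε / n` in the values of `x`; the gap
closes only after a definite amount of flow has crossed it, and connectedness provides this flow,
which costs a definite amount of energy (`exists_energy_drop`). Energy being non-negative, the
spread of `x(t)` has to become small, and then `π(T) ⬝ x(T)` hardly depends on `π(T)`.
-/

namespace StochasticChain

variable {n : ℕ}

/-! ### Elementary facts on cuts -/

theorem cut_nonneg {M : Matrix (Fin n) (Fin n) ℝ} (hM : M ∈ Matrix.rowStochastic ℝ (Fin n))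
    (S : Finset (Fin n)) : 0 ≤ cut M S :=
  Finset.sum_nonneg fun _ _ => Finset.sum_nonneg fun _ _ => hM.1 _ _

theorem row_sum_eq_one {M : Matrix (Fin n) (Fin n) ℝ} (hM : M ∈ Matrix.rowStochastic ℝ (Fin n))
    (i : Fin n) : ∑ j, M i j = 1 :=
  Matrix.sum_row_of_mem_rowStochastic hM i

theorem row_sum_compl_le_cut {M : Matrix (Fin n) (Fin n) ℝ}
    (hM : M ∈ Matrix.rowStochastic ℝ (Fin n)) {S : Finset (Fin n)} {i : Fin n} (hi : i ∈ S) :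
    ∑ j ∈ Sᶜ, M i j ≤ cut M S :=
  Finset.single_le_sum (f := fun i => ∑ j ∈ Sᶜ, M i j)
    (fun _ _ => Finset.sum_nonneg fun _ _ => hM.1 _ _) hi

theorem entry_le_cut {M : Matrix (Fin n) (Fin n) ℝ}
    (hM : M ∈ Matrix.rowStochastic ℝ (Fin n)) {S : Finset (Fin n)} {i j : Fin n} (hi : i ∈ S)
    (hj : j ∉ S) : M i j ≤ cut M S :=
  (Finset.single_le_sum (f := fun j => M i j) (fun _ _ => hM.1 _ _)
    (Finset.mem_compl.2 hj)).trans (row_sum_compl_le_cut hM hi)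

/-! ### Backward evolution of mass -/

/-- Mass balance of `S` in one backward step. -/
theorem sum_vecMul {M : Matrix (Fin n) (Fin n) ℝ} (hM : M ∈ Matrix.rowStochastic ℝ (Fin n))
    (w : Fin n → ℝ) (S : Finset (Fin n)) :
    ∑ j ∈ S, Matrix.vecMul w M j =
      ∑ i ∈ S, w i * (1 - ∑ j ∈ Sᶜ, M i j) + ∑ i ∈ Sᶜ, w i * ∑ j ∈ S, M i j := by
  have h1 : ∀ i, 1 - ∑ j ∈ Sᶜ, M i j = ∑ j ∈ S, M i j := fun i => by
    rw [← row_sum_eq_one hM i, ← Finset.sum_add_sum_compl S]; ring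
  simp only [h1, Matrix.vecMul, dotProduct]
  rw [Finset.sum_comm, Finset.sum_add_sum_compl S (fun i => w i * ∑ j ∈ S, M i j)]
  simp only [Finset.mul_sum]

theorem le_sum_vecMul {M : Matrix (Fin n) (Fin n) ℝ} (hM : M ∈ Matrix.rowStochastic ℝ (Fin n))
    {w : Fin n → ℝ} (hw : ∀ i, 0 ≤ w i) (S : Finset (Fin n)) {e : ℝ}
    (he : ∀ i ∉ S, e ≤ w i) :
    (1 - cut M S) * ∑ i ∈ S, w i + e * cut M Sᶜ ≤ ∑ j ∈ S, Matrix.vecMul w M j := by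
  rw [sum_vecMul hM, Finset.mul_sum]
  refine add_le_add (Finset.sum_le_sum fun i hi => ?_) ?_
  · rw [mul_comm]
    exact mul_le_mul_of_nonneg_left (by linarith [row_sum_compl_le_cut hM hi]) (hw i)
  · rw [cut, compl_compl, Finset.mul_sum]
    exact Finset.sum_le_sum fun i hi => mul_le_mul_of_nonneg_right
      (he i (Finset.mem_compl.1 hi)) (Finset.sum_nonneg fun _ _ => hM.1 _ _)

theorem diag_mul_le_sum_vecMul {M : Matrix (Fin n) (Fin n) ℝ}
    (hM : M ∈ Matrix.rowStochastic ℝ (Fin n)) {w : Fin n → ℝ} (hw : ∀ i, 0 ≤ w i)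
    (S : Finset (Fin n)) {γ : ℝ} (hγ : ∀ i, γ ≤ M i i) :
    γ * ∑ i ∈ S, w i ≤ ∑ j ∈ S, Matrix.vecMul w M j := by
  rw [Finset.mul_sum]
  refine Finset.sum_le_sum fun j _ => ?_
  calc γ * w j ≤ w j * M j j := by
        rw [mul_comm]; exact mul_le_mul_of_nonneg_left (hγ j) (hw j)
    _ ≤ ∑ i, w i * M i j :=
        Finset.single_le_sum (f := fun i => w i * M i j)
          (fun i _ => mul_nonneg (hw i) (hM.1 i j)) (Finset.mem_univ j)

theorem vecMul_mem_stdSimplex {M : Matrix (Fin n) (Fin n) ℝ}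
    (hM : M ∈ Matrix.rowStochastic ℝ (Fin n)) {w : Fin n → ℝ} (hw : w ∈ stdSimplex ℝ (Fin n)) :
    Matrix.vecMul w M ∈ stdSimplex ℝ (Fin n) := by
  refine ⟨fun j => ?_, ?_⟩
  · simp only [Matrix.vecMul, dotProduct]
    exact Finset.sum_nonneg fun i _ => mul_nonneg (hw.1 i) (hM.1 i j)
  rw [sum_vecMul hM w Finset.univ]
  simpa using hw.2

/-- `backward A v t k` is the result at time `t` of starting the backward dynamics with `v` at time
`t + k`, that is, `vᵀ A(t+k-1) ⋯ A(t)`. -/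
def backward (A : ℕ → Matrix (Fin n) (Fin n) ℝ) (v : Fin n → ℝ) : ℕ → ℕ → Fin n → ℝ
  | _, 0 => v
  | t, k + 1 => Matrix.vecMul (backward A v (t + 1) k) (A t)

/-- `π` is an absolute probability sequence up to time `T`: the recursion is required only for
`t < T`. -/
def IsBackwardTrajectory (A : ℕ → Matrix (Fin n) (Fin n) ℝ) (T : ℕ) (π : ℕ → Fin n → ℝ) : Prop :=
  (∀ t, π t ∈ stdSimplex ℝ (Fin n)) ∧ ∀ t < T, Matrix.vecMul (π (t + 1)) (A t) = π t

theorem exists_isBackwardTrajectory {A : ℕ → Matrix (Fin n) (Fin n) ℝ} (hA : IsStochasticChain A)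
    {v : Fin n → ℝ} (hv : v ∈ stdSimplex ℝ (Fin n)) (T : ℕ) :
    ∃ π, IsBackwardTrajectory A T π ∧ π T = v := by
  have hmem : ∀ k t, backward A v t k ∈ stdSimplex ℝ (Fin n) := by
    intro k
    induction k with
    | zero => exact fun _ => hv
    | succ k ih => exact fun t => vecMul_mem_stdSimplex (hA t) (ih (t + 1))
  refine ⟨fun t => backward A v t (T - t), ⟨fun t => hmem _ t, fun t ht => ?_⟩, ?_⟩
  · obtain ⟨k, rfl⟩ := Nat.exists_eq_add_of_lt ht
    have h1 : t + k + 1 - (t + 1) = k := by omega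
    have h2 : t + k + 1 - t = k + 1 := by omega
    simp only [h1, h2, backward]
  · simp [backward]

/-- A cluster point of backward trajectories with horizons tending to infinity is an absolute
probability sequence, and it inherits closed conditions that hold up to the horizon. -/
theorem exists_absoluteProbabilitySequence {A : ℕ → Matrix (Fin n) (Fin n) ℝ}
    {q : ℕ → ℕ → Fin n → ℝ} (hq : ∀ T, IsBackwardTrajectory A T (q T))
    {C : ℕ → Set (Fin n → ℝ)} (hC : ∀ t, IsClosed (C t)) (hqC : ∀ T, ∀ t ≤ T, q T t ∈ C t) :
    ∃ π, IsAbsoluteProbabilitySequence A π ∧ ∀ t, π t ∈ C t := by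
  have hcpt : ∀ t, ∃ p ∈ stdSimplex ℝ (Fin n),
      Filter.Tendsto (fun T => q T t) (Filter.hyperfilter ℕ : Filter ℕ) (nhds p) := by
    intro t
    refine (isCompact_stdSimplex ℝ (Fin n)).ultrafilter_le_nhds
      ((Filter.hyperfilter ℕ).map (fun T => q T t)) ?_
    rw [Ultrafilter.coe_map, Filter.le_principal_iff]
    exact Filter.Eventually.of_forall (f := (Filter.hyperfilter ℕ : Filter ℕ))
      fun T => (hq T).1 t
  choose π hπ hlim using hcpt
  have hev : ∀ t, ∀ᶠ T in (Filter.hyperfilter ℕ : Filter ℕ), t < T := fun t =>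
    Nat.hyperfilter_le_atTop (Filter.eventually_gt_atTop t)
  refine ⟨π, ⟨hπ, fun t => ?_⟩, fun t => (hC t).mem_of_tendsto (hlim t)
    ((hev t).mono fun T hT => hqC T t hT.le)⟩
  have hcont : Continuous fun w : Fin n → ℝ => Matrix.vecMul w (A t) :=
    continuous_id.matrix_vecMul continuous_const
  refine tendsto_nhds_unique (((hcont.tendsto _).comp (hlim (t + 1)))) ?_
  exact (hlim t).congr' ((hev t).mono fun T hT => ((hq T).2 t hT).symm)

/-! ### Uniform lower bound for backward trajectories -/

theorem le_of_step_add {u h : ℕ → ℝ} {a b : ℕ} (hab : a ≤ b)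
    (hstep : ∀ s, a ≤ s → s < b → u (s + 1) + h s ≤ u s) :
    u b + ∑ s ∈ Finset.Ico a b, h s ≤ u a := by
  induction b, hab using Nat.le_induction with
  | base => simp
  | succ b hab ih =>
    rw [Finset.sum_Ico_succ_top hab]
    linarith [ih fun s hs hsb => hstep s hs (by omega), hstep b hab (by omega)]

/-- Losing in each step at most the fraction `min (f s) (1 - γ)` costs in total at most the factor
`exp (-(∑ f) / γ)`. -/
theorem exp_mul_le_of_step {u f : ℕ → ℝ} {γ : ℝ} (hγ : 0 < γ) {a b : ℕ} (hab : a ≤ b)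
    (hu : ∀ s, 0 ≤ u s) (hf : ∀ s, 0 ≤ f s)
    (h1 : ∀ s, a ≤ s → s < b → γ * u (s + 1) ≤ u s)
    (h2 : ∀ s, a ≤ s → s < b → (1 - f s) * u (s + 1) ≤ u s) :
    Real.exp (-(∑ s ∈ Finset.Ico a b, f s) / γ) * u b ≤ u a := by
  induction b, hab using Nat.le_induction with
  | base => simp
  | succ b hab ih =>
    rw [Finset.sum_Ico_succ_top hab]
    refine le_trans ?_ (ih (fun s hs hsb => h1 s hs (by omega)) fun s hs hsb => h2 s hs (by omega))
    rw [neg_add, add_div, Real.exp_add, mul_assoc]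
    refine mul_le_mul_of_nonneg_left ?_ (Real.exp_pos _).le
    set r := max γ (1 - f b) with hr
    have hrγ : γ ≤ r := le_max_left _ _
    have hr0 : 0 < r := hγ.trans_le hrγ
    have hru : r * u (b + 1) ≤ u b := by
      rcases max_choice γ (1 - f b) with h | h <;> rw [hr, h]
      exacts [h1 b hab (by omega), h2 b hab (by omega)]
    refine (mul_le_mul_of_nonneg_right ?_ (hu _)).trans hru
    rw [← Real.le_log_iff_exp_le hr0]
    refine le_trans ?_ (Real.one_sub_inv_le_log_of_pos hr0)
    have h3 : r⁻¹ - 1 ≤ f b / γ := by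
      rw [le_div_iff₀ hγ]
      have h4 : (r⁻¹ - 1) * r = 1 - r := by field_simp
      rcases le_total r 1 with h5 | h5
      · have h6 : 0 ≤ r⁻¹ - 1 := sub_nonneg.2 ((one_le_inv₀ hr0).2 h5)
        have := mul_le_mul_of_nonneg_left hrγ h6
        linarith [le_max_right γ (1 - f b)]
      · have h6 : r⁻¹ - 1 ≤ 0 := sub_nonpos.2 (inv_le_one_of_one_le₀ h5)
        exact (mul_nonpos_of_nonpos_of_nonneg h6 hγ.le).trans (hf b)
    rw [neg_div]; linarith

/-- The lower bound for an excursion: while the mass of `S` is below `η`, each vertex outside `S`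
has mass at least `e`. -/
theorem mass_lower_bound {A : ℕ → Matrix (Fin n) (Fin n) ℝ} (hA : IsStochasticChain A)
    {γ p₀ β e η : ℝ} (hγ : 0 < γ) (hdiag : ∀ t i, γ ≤ A t i i) (hp₀ : 0 < p₀) (hβ : 0 < β)
    (he : 0 < e) (hη : 0 < η) (hηe : η ≤ e * p₀ / 2) {S : Finset (Fin n)}
    (hrec : ∀ t₀ t₁ : ℕ, t₀ < t₁ → p₀ * ∑ t ∈ Finset.Ico t₀ t₁, cut (A t) S ≤
      (∑ t ∈ Finset.Ico t₀ t₁, cut (A t) Sᶜ) + β)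
    {T : ℕ} {π : ℕ → Fin n → ℝ} (hπ : IsBackwardTrajectory A T π)
    (hT : η ≤ ∑ i ∈ S, π T i)
    (hout : ∀ t ≤ T, ∑ i ∈ S, π t i < η → ∀ i ∉ S, e ≤ π t i) {t : ℕ} (ht : t ≤ T) :
    Real.exp (-(2 * β / p₀) / γ) * (min γ 1 * η) ≤ ∑ i ∈ S, π t i := by
  classical
  have hexp1 : Real.exp (-(2 * β / p₀) / γ) ≤ 1 :=
    Real.exp_le_one_iff.2 (div_nonpos_of_nonpos_of_nonneg (by
      rw [neg_nonpos]; positivity) hγ.le)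
  set u : ℕ → ℝ := fun s => ∑ i ∈ S, π s i with hu
  have hu0 : ∀ s, 0 ≤ u s := fun s => Finset.sum_nonneg fun i _ => (hπ.1 s).1 i
  have hex : ∃ s, t ≤ s ∧ s ≤ T ∧ η ≤ u s := ⟨T, ht, le_rfl, hT⟩
  obtain ⟨hts, hsT, hηs⟩ := Nat.find_spec hex
  have hmin : ∀ s, t ≤ s → s < Nat.find hex → u s < η := fun s hs hs' => by
    have := Nat.find_min hex hs'
    by_contra h
    exact this ⟨hs, by omega, not_lt.1 h⟩
  set s₁ := Nat.find hex
  have hmη : 0 ≤ min γ 1 * η := mul_nonneg (le_min hγ.le zero_le_one) hη.le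
  have hγstep : ∀ s < T, γ * u (s + 1) ≤ u s := fun s hs => by
    simpa only [hu, ← hπ.2 s hs] using
      diag_mul_le_sum_vecMul (hA s) (hπ.1 (s + 1)).1 S (hdiag s)
  -- `b` is the last time of the excursion below `η`, or `t` itself if there is none
  obtain ⟨b, htb, hbT, hub, hbmin⟩ : ∃ b, t ≤ b ∧ b ≤ T ∧ min γ 1 * η ≤ u b ∧
      ∀ s, t ≤ s → s < b → u (s + 1) < η := by
    rcases hts.eq_or_lt with h | h
    · refine ⟨t, le_rfl, ht, ?_, fun s _ _ => by omega⟩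
      rw [h]
      exact le_trans (mul_le_of_le_one_left hη.le (min_le_right _ _)) hηs
    · refine ⟨s₁ - 1, by omega, by omega, ?_, fun s hs hs' => hmin _ (by omega) (by omega)⟩
      have := hγstep (s₁ - 1) (by omega)
      rw [Nat.sub_add_cancel (by omega)] at this
      refine le_trans ?_ this
      exact mul_le_mul (min_le_left _ _) hηs hη.le hγ.le
  set F := ∑ s ∈ Finset.Ico t b, cut (A s) S with hF
  set G := ∑ s ∈ Finset.Ico t b, cut (A s) Sᶜ with hG
  have hstep : ∀ s, t ≤ s → s < b →
      (1 - cut (A s) S) * u (s + 1) + e * cut (A s) Sᶜ ≤ u s := fun s hs hsb => by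
    simpa only [hu, ← hπ.2 s (hsb.trans_le hbT)] using
      le_sum_vecMul (hA s) (hπ.1 (s + 1)).1 S (hout (s + 1) (by omega) (hbmin s hs hsb))
  rcases le_or_gt (2 * β / p₀) F with hlarge | hsmall
  · have htb' : t < b := by
      rcases htb.eq_or_lt with h | h
      · have : 0 < 2 * β / p₀ := by positivity
        rw [hF, ← h] at hlarge
        simp at hlarge
        linarith
      · exact h
    have h1 := le_of_step_add (u := u) (h := fun s => -η * cut (A s) S + e * cut (A s) Sᶜ) htb
      fun s hs hsb => by
        have h2 := mul_le_mul_of_nonneg_left (hbmin s hs hsb).le (cut_nonneg (hA s) S)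
        linarith [hstep s hs hsb]
    rw [Finset.sum_add_distrib, ← Finset.mul_sum, ← Finset.mul_sum, ← hF, ← hG] at h1
    have h2 := hrec t b htb'
    rw [← hF, ← hG] at h2
    have hF0 : 0 ≤ F := Finset.sum_nonneg fun s _ => cut_nonneg (hA s) S
    rw [div_le_iff₀ hp₀] at hlarge
    have h3 := mul_le_mul_of_nonneg_right hηe hF0
    have h4 := mul_le_mul_of_nonneg_left h2 he.le
    have h5 := mul_le_mul_of_nonneg_left hlarge he.le
    have h6 : min γ 1 * η ≤ u t := by linarith
    exact (mul_le_of_le_one_left hmη hexp1).trans h6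
  · have h1 := exp_mul_le_of_step (u := u) hγ htb hu0 (fun s => cut_nonneg (hA s) S)
      (fun s _ hsb => hγstep s (hsb.trans_le hbT)) fun s hs hsb =>
        le_trans (le_add_of_nonneg_right (mul_nonneg he.le (cut_nonneg (hA s) _)))
          (hstep s hs hsb)
    refine le_trans (mul_le_mul (Real.exp_le_exp.2 ?_) hub hmη (Real.exp_pos _).le) h1
    exact div_le_div_of_nonneg_right (neg_le_neg hsmall.le) hγ.le

/-- Backward trajectories that start from the uniform vector are bounded below, uniformly in the
starting time. -/
theorem exists_uniform_lower_bound {A : ℕ → Matrix (Fin n) (Fin n) ℝ} (hA : IsStochasticChain A)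
    (haper : StronglyAperiodic A) (hrec : ApproxReciprocal A) :
    ∃ p : ℝ, 0 < p ∧ ∀ T π, IsBackwardTrajectory A T π → (∀ i, π T i = (n : ℝ)⁻¹) →
      ∀ t ≤ T, ∀ i, p ≤ π t i := by
  obtain ⟨γ, hγ, hdiag⟩ := haper
  obtain ⟨p₀, β, hp₀, hβ, hrec⟩ := hrec
  rcases Nat.eq_zero_or_pos n with rfl | hn
  · exact ⟨1, one_pos, fun _ _ _ _ _ _ i => i.elim0⟩
  have hn' : (0 : ℝ) < n := Nat.cast_pos.2 hn
  have key : ∀ m ≤ n - 1, ∃ ε : ℝ, 0 < ε ∧ ∀ T π, IsBackwardTrajectory A T π →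
      (∀ i, π T i = (n : ℝ)⁻¹) → ∀ t ≤ T, ∀ S : Finset (Fin n), n - m ≤ S.card →
        ε ≤ ∑ i ∈ S, π t i := by
    intro m
    induction m with
    | zero =>
      refine fun _ => ⟨1, one_pos, fun T π hπ _ t _ S hS => ?_⟩
      have : S = Finset.univ := Finset.eq_univ_of_card S
        (le_antisymm (Finset.card_le_univ S) (by simpa using hS))
      rw [this, (hπ.1 t).2]
    | succ m ih =>
      intro hm
      obtain ⟨ε, hε, hbound⟩ := ih (by omega)
      set η : ℝ := min (ε / 2) (min (ε / 2 * p₀ / 2) (n : ℝ)⁻¹) with hηdef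
      have hη : 0 < η := by positivity
      have hη1 : η ≤ ε / 2 := min_le_left _ _
      have hη2 : η ≤ ε / 2 * p₀ / 2 := (min_le_right _ _).trans (min_le_left _ _)
      have hη3 : η ≤ (n : ℝ)⁻¹ := (min_le_right _ _).trans (min_le_right _ _)
      refine ⟨min ε (Real.exp (-(2 * β / p₀) / γ) * (min γ 1 * η)), by positivity,
        fun T π hπ hπT t ht S hS => ?_⟩
      rcases Nat.lt_or_ge S.card (n - m) with hlt | hge
      · refine (min_le_right _ _).trans (mass_lower_bound hA hγ hdiag hp₀ hβ (half_pos hε) hη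
          hη2 (hrec S) hπ ?_ ?_ ht)
        · have hcard : (1 : ℝ) ≤ S.card := by exact_mod_cast (by omega : 1 ≤ S.card)
          simp only [hπT, Finset.sum_const, nsmul_eq_mul]
          exact hη3.trans (le_mul_of_one_le_left (by positivity) hcard)
        · intro s hs hlow i hi
          have := hbound T π hπ hπT s hs (insert i S) (by
            rw [Finset.card_insert_of_notMem hi]; omega)
          rw [Finset.sum_insert hi] at this
          linarith
      · exact (min_le_left _ _).trans (hbound T π hπ hπT t ht S hge)
  obtain ⟨ε, hε, hbound⟩ := key (n - 1) le_rfl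
  refine ⟨ε, hε, fun T π hπ hπT t ht i => ?_⟩
  have := hbound T π hπ hπT t ht {i} (by rw [Finset.card_singleton]; omega)
  simpa using this

theorem exists_absoluteProbabilitySequence_pos {A : ℕ → Matrix (Fin n) (Fin n) ℝ} (hn : 0 < n)
    (hA : IsStochasticChain A) (haper : StronglyAperiodic A) (hrec : ApproxReciprocal A) :
    ∃ p : ℝ, 0 < p ∧ ∃ π, IsAbsoluteProbabilitySequence A π ∧ ∀ t i, p ≤ π t i := by
  obtain ⟨p, hp, hbound⟩ := exists_uniform_lower_bound hA haper hrec
  have hn' : (n : ℝ) ≠ 0 := Nat.cast_ne_zero.2 hn.ne'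
  have hv : (fun _ => (n : ℝ)⁻¹) ∈ stdSimplex ℝ (Fin n) :=
    ⟨fun _ => by positivity, by simp [hn']⟩
  choose q hq hqT using exists_isBackwardTrajectory hA hv
  have hclosed : IsClosed {w : Fin n → ℝ | ∀ i, p ≤ w i} := by
    simp only [Set.ofPred_forall]
    exact isClosed_iInter fun i => isClosed_le continuous_const (continuous_apply i)
  obtain ⟨π, hπ, hπp⟩ := exists_absoluteProbabilitySequence hq
    (C := fun _ => {w | ∀ i, p ≤ w i}) (fun _ => hclosed)
    fun T t ht => hbound T (q T) (hq T) (fun i => by rw [hqT]) t ht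
  exact ⟨p, hp, π, hπ, hπp⟩

/-! ### Energy decrease of the forward dynamics -/

/-- The variance of the values `x j` under the weights `a` dominates their mean square deviation
from `x i`, as the weight of `i` is not small. -/
theorem row_variance {a x : Fin n → ℝ} (ha : ∀ j, 0 ≤ a j) (hsum : ∑ j, a j = 1) {γ : ℝ}
    (i : Fin n) (hγ : γ ≤ a i) :
    γ * ∑ j, a j * (x i - x j) ^ 2 ≤
      (1 + γ) * (∑ j, a j * x j ^ 2 - (∑ j, a j * x j) ^ 2) := by
  set y := ∑ j, a j * x j with hy
  have hmean : ∀ c : ℝ, ∑ j, a j * (c - x j) ^ 2 = c ^ 2 - 2 * c * y + ∑ j, a j * x j ^ 2 := by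
    intro c
    have : ∀ j, a j * (c - x j) ^ 2 = c ^ 2 * a j - 2 * c * (a j * x j) + a j * x j ^ 2 :=
      fun j => by ring
    simp only [this, Finset.sum_add_distrib, Finset.sum_sub_distrib, ← Finset.mul_sum, hsum, ← hy]
    ring
  have h1 : a i * (y - x i) ^ 2 ≤ ∑ j, a j * (y - x j) ^ 2 :=
    Finset.single_le_sum (f := fun j => a j * (y - x j) ^ 2)
      (fun j _ => mul_nonneg (ha j) (sq_nonneg _)) (Finset.mem_univ i)
  have h2 : γ * (y - x i) ^ 2 ≤ a i * (y - x i) ^ 2 :=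
    mul_le_mul_of_nonneg_right hγ (sq_nonneg _)
  rw [hmean] at h1 ⊢
  nlinarith

/-- `energy w x` is the second moment `∑ wᵢ xᵢ²` of `x` under the weights `w`. -/
def energy (w x : Fin n → ℝ) : ℝ := ∑ i, w i * x i ^ 2

theorem energy_decrease {M : Matrix (Fin n) (Fin n) ℝ} (hM : M ∈ Matrix.rowStochastic ℝ (Fin n))
    {γ p : ℝ} (hγ : 0 < γ) (hdiag : ∀ i, γ ≤ M i i) {w : Fin n → ℝ} (hp : 0 < p)
    (hw : ∀ i, p ≤ w i) (x : Fin n → ℝ) :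
    energy w (Matrix.mulVec M x) + p * γ / (1 + γ) * ∑ i, ∑ j, M i j * (x i - x j) ^ 2 ≤
      energy (Matrix.vecMul w M) x := by
  have h1 : energy (Matrix.vecMul w M) x = ∑ i, w i * ∑ j, M i j * x j ^ 2 := by
    simp only [energy, Matrix.vecMul, dotProduct, Finset.sum_mul, Finset.mul_sum]
    rw [Finset.sum_comm]
    exact Finset.sum_congr rfl fun i _ => Finset.sum_congr rfl fun j _ => by ring
  rw [h1, energy, Finset.mul_sum, ← Finset.sum_add_distrib]
  refine Finset.sum_le_sum fun i _ => ?_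
  have h2 := row_variance (x := x) (fun j => hM.1 i j) (row_sum_eq_one hM i) i (hdiag i)
  have h3 : 0 ≤ ∑ j, M i j * (x i - x j) ^ 2 :=
    Finset.sum_nonneg fun j _ => mul_nonneg (hM.1 i j) (sq_nonneg _)
  simp only [Matrix.mulVec, dotProduct]
  set Q := ∑ j, M i j * (x i - x j) ^ 2
  set V := ∑ j, M i j * x j ^ 2
  set y := ∑ j, M i j * x j
  have hγ1 : 0 < 1 + γ := by linarith
  have h4 : γ / (1 + γ) * Q ≤ V - y ^ 2 := by
    rw [div_mul_eq_mul_div, div_le_iff₀ hγ1]; linarith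
  have h5 : p * (γ / (1 + γ) * Q) ≤ w i * (V - y ^ 2) :=
    mul_le_mul (hw i) h4 (by positivity) (hp.le.trans (hw i))
  have h6 : p * γ / (1 + γ) * Q = p * (γ / (1 + γ) * Q) := by ring
  rw [h6]; linarith

theorem mul_cut_le_sum {M : Matrix (Fin n) (Fin n) ℝ} (hM : M ∈ Matrix.rowStochastic ℝ (Fin n))
    {S : Finset (Fin n)} {δ : ℝ} (hδ : 0 ≤ δ) {x : Fin n → ℝ}
    (hgap : ∀ i ∈ S, ∀ j ∉ S, δ ≤ x i - x j) :
    δ ^ 2 * (cut M S + cut M Sᶜ) ≤ ∑ i, ∑ j, M i j * (x i - x j) ^ 2 := by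
  have hcut : ∀ R : Finset (Fin n), (∀ i ∈ R, ∀ j ∈ Rᶜ, δ ^ 2 ≤ (x i - x j) ^ 2) →
      δ ^ 2 * cut M R ≤ ∑ i ∈ R, ∑ j, M i j * (x i - x j) ^ 2 := by
    intro R hR
    simp only [cut, Finset.mul_sum]
    refine Finset.sum_le_sum fun i hi => ?_
    calc ∑ j ∈ Rᶜ, δ ^ 2 * M i j ≤ ∑ j ∈ Rᶜ, M i j * (x i - x j) ^ 2 :=
          Finset.sum_le_sum fun j hj => by
            rw [mul_comm]; exact mul_le_mul_of_nonneg_left (hR i hi j hj) (hM.1 i j)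
      _ ≤ ∑ j, M i j * (x i - x j) ^ 2 :=
          Finset.sum_le_sum_of_subset_of_nonneg (Finset.subset_univ _)
            fun j _ _ => mul_nonneg (hM.1 i j) (sq_nonneg _)
  rw [mul_add, ← Finset.sum_add_sum_compl S]
  refine add_le_add (hcut S fun i hi j hj => ?_) (hcut Sᶜ fun i hi j hj => ?_)
  · exact pow_le_pow_left₀ hδ (hgap i hi j (Finset.mem_compl.1 hj)) 2
  · rw [compl_compl] at hj
    rw [← neg_sub (x j), neg_sq]
    exact pow_le_pow_left₀ hδ (hgap j hj i (Finset.mem_compl.1 hi)) 2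

/-! ### Gaps and their persistence -/

/-- If `n` values spread over at least `ε`, then one of the `n` open intervals of length `ε / n`
above the smaller value `x j` contains none of them. -/
theorem exists_gap {x : Fin n → ℝ} {ε : ℝ} (hε : 0 < ε) {i j : Fin n} (hij : ε ≤ x i - x j) :
    ∃ (S : Finset (Fin n)) (c : ℝ), i ∈ S ∧ j ∉ S ∧ (∀ k ∈ S, c + ε / n ≤ x k) ∧
      ∀ k ∉ S, x k ≤ c := by
  classical
  have hn : (0 : ℝ) < n := Nat.cast_pos.2 i.pos
  set δ := ε / n with hδdef
  have hδ : 0 < δ := by positivity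
  have hnδ : n * δ = ε := by rw [hδdef]; field_simp
  obtain ⟨m, hm⟩ : ∃ m : Fin n, ∀ k, x k ≤ x j + m * δ ∨ x j + (m + 1) * δ ≤ x k := by
    by_contra! h
    choose f hf1 hf2 using h
    have hinj : Function.Injective f := by
      have hle : ∀ a b, f a = f b → a ≤ b := by
        intro a b hab
        have h1 := hf1 a
        have h2 := hf2 b
        rw [hab] at h1
        have h3 : (a : ℝ) < b + 1 := by
          by_contra! h4
          have := mul_le_mul_of_nonneg_right h4 hδ.le
          linarith
        exact Fin.le_def.2 (Nat.lt_succ_iff.1 (by exact_mod_cast h3))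
      exact fun a b hab => le_antisymm (hle a b hab) (hle b a hab.symm)
    obtain ⟨a, ha⟩ := (Finite.injective_iff_surjective.1 hinj) j
    have h1 := hf1 a
    rw [ha] at h1
    have h2 : 0 ≤ (a : ℝ) * δ := by positivity
    linarith
  have hm' : ((m : ℝ) + 1) * δ ≤ ε := by
    rw [← hnδ]
    exact mul_le_mul_of_nonneg_right (by exact_mod_cast m.isLt) hδ.le
  have hm0 : 0 ≤ (m : ℝ) * δ := by positivity
  refine ⟨Finset.univ.filter fun k => x j + (m + 1) * δ ≤ x k, x j + m * δ, ?_, ?_, ?_, ?_⟩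
  · simp only [Finset.mem_filter, Finset.mem_univ, true_and]; linarith
  · simp only [Finset.mem_filter, Finset.mem_univ, true_and, not_le]; linarith
  · intro k hk
    simp only [Finset.mem_filter, Finset.mem_univ, true_and] at hk
    linarith
  · intro k hk
    simp only [Finset.mem_filter, Finset.mem_univ, true_and] at hk
    exact (hm k).resolve_right hk

theorem le_mulVec {M : Matrix (Fin n) (Fin n) ℝ} (hM : M ∈ Matrix.rowStochastic ℝ (Fin n))
    {S : Finset (Fin n)} {x : Fin n → ℝ} {l c : ℝ} (hl : ∀ i, l ≤ x i) (hc : ∀ i ∈ S, c ≤ x i)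
    (hlc : c ≤ l + 1) {i : Fin n} (hi : i ∈ S) : c - cut M S ≤ Matrix.mulVec M x i := by
  have h1 : ∑ j ∈ S, M i j = 1 - ∑ j ∈ Sᶜ, M i j := by
    rw [← row_sum_eq_one hM i, ← Finset.sum_add_sum_compl S]; ring
  have h2 : ∑ j ∈ S, M i j * c ≤ ∑ j ∈ S, M i j * x j :=
    Finset.sum_le_sum fun j hj => mul_le_mul_of_nonneg_left (hc j hj) (hM.1 i j)
  have h3 : ∑ j ∈ Sᶜ, M i j * (c - 1) ≤ ∑ j ∈ Sᶜ, M i j * x j :=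
    Finset.sum_le_sum fun j _ => mul_le_mul_of_nonneg_left (by linarith [hl j]) (hM.1 i j)
  rw [← Finset.sum_mul] at h2 h3
  rw [h1] at h2
  have h4 := row_sum_compl_le_cut hM hi
  simp only [Matrix.mulVec, dotProduct]
  rw [← Finset.sum_add_sum_compl S]
  linarith

/-- Values on `S` that start above `c` decrease at most by the total flow out of `S`. -/
theorem le_of_forward {A : ℕ → Matrix (Fin n) (Fin n) ℝ} (hA : IsStochasticChain A)
    {x : ℕ → Fin n → ℝ} {t₀ : ℕ} (hx : ∀ t ≥ t₀, x (t + 1) = Matrix.mulVec (A t) (x t)) {l c : ℝ}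
    (hl : ∀ t ≥ t₀, ∀ i, l ≤ x t i) (hlc : c ≤ l + 1) {S : Finset (Fin n)}
    (hc : ∀ i ∈ S, c ≤ x t₀ i) {t : ℕ} (ht : t₀ ≤ t) :
    ∀ i ∈ S, c - ∑ s ∈ Finset.Ico t₀ t, cut (A s) S ≤ x t i := by
  induction t, ht using Nat.le_induction with
  | base => simpa using hc
  | succ t ht ih =>
    intro i hi
    rw [Finset.sum_Ico_succ_top ht, hx t ht, ← sub_sub]
    refine le_mulVec (hA t) (hl t ht) ih ?_ hi
    have := Finset.sum_nonneg fun s (_ : s ∈ Finset.Ico t₀ t) => cut_nonneg (hA s) S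
    linarith

theorem le_forward {A : ℕ → Matrix (Fin n) (Fin n) ℝ} (hA : IsStochasticChain A)
    {x : ℕ → Fin n → ℝ} {t₀ : ℕ} (hx : ∀ t ≥ t₀, x (t + 1) = Matrix.mulVec (A t) (x t)) {l : ℝ}
    (hl : ∀ i, l ≤ x t₀ i) {t : ℕ} (ht : t₀ ≤ t) : ∀ i, l ≤ x t i := by
  induction t, ht using Nat.le_induction with
  | base => exact hl
  | succ t ht ih =>
    intro i
    rw [hx t ht]
    calc l = ∑ j, A t i j * l := by rw [← Finset.sum_mul, row_sum_eq_one (hA t), one_mul]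
      _ ≤ ∑ j, A t i j * x t j :=
        Finset.sum_le_sum fun j _ => mul_le_mul_of_nonneg_left (ih j) ((hA t).1 i j)

theorem forward_neg {A : ℕ → Matrix (Fin n) (Fin n) ℝ}
    {x : ℕ → Fin n → ℝ} {t₀ : ℕ} (hx : ∀ t ≥ t₀, x (t + 1) = Matrix.mulVec (A t) (x t)) :
    ∀ t ≥ t₀, -x (t + 1) = Matrix.mulVec (A t) (-x t) := fun t ht => by
  rw [Matrix.mulVec_neg, hx t ht]

/-! ### Infinite flow and contraction of the spread -/

theorem tendsto_cut_of_connected {A : ℕ → Matrix (Fin n) (Fin n) ℝ} (hA : IsStochasticChain A)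
    (hconn : (infiniteFlowGraph A).Connected) {S : Finset (Fin n)} {i j : Fin n} (hi : i ∈ S)
    (hj : j ∉ S) (t₀ : ℕ) : Filter.Tendsto
      (fun T => ∑ t ∈ Finset.Ico t₀ T, (cut (A t) S + cut (A t) Sᶜ)) Filter.atTop
      Filter.atTop := by
  obtain ⟨w⟩ := hconn.preconnected i j
  obtain ⟨d, -, hd1, hd2⟩ := w.exists_boundary_dart (S : Set (Fin n)) hi hj
  have hd := d.adj.2
  have h1 : Filter.Tendsto (fun T => ∑ t ∈ Finset.range T, (cut (A t) S + cut (A t) Sᶜ))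
      Filter.atTop Filter.atTop := by
    refine Filter.tendsto_atTop_mono (fun T => Finset.sum_le_sum fun t _ => ?_) hd
    refine add_le_add (entry_le_cut (hA t) hd1 hd2) (entry_le_cut (hA t) ?_ ?_)
    · exact Finset.mem_compl.2 hd2
    · simpa using hd1
  have h2 := Filter.tendsto_atTop_add_const_right _
    (-∑ t ∈ Finset.range t₀, (cut (A t) S + cut (A t) Sᶜ)) h1
  refine h2.congr' ?_
  filter_upwards [Filter.eventually_ge_atTop t₀] with T hT
  rw [Finset.sum_Ico_eq_sub _ hT, sub_eq_add_neg]

/-- From any time at which the spread of `x` is at least `ε`, the energy decreases within finite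
time by an amount depending only on `ε` (and on `n`, `p`, `γ`). -/
theorem exists_energy_drop {A : ℕ → Matrix (Fin n) (Fin n) ℝ} (hA : IsStochasticChain A)
    (hconn : (infiniteFlowGraph A).Connected) {γ p : ℝ} (hγ : 0 < γ) (hdiag : ∀ t i, γ ≤ A t i i)
    (hp : 0 < p) {π : ℕ → Fin n → ℝ} (hπ : IsAbsoluteProbabilitySequence A π)
    (hπp : ∀ t i, p ≤ π t i) {x : ℕ → Fin n → ℝ} {t₀ : ℕ}
    (hx : ∀ t ≥ t₀, x (t + 1) = Matrix.mulVec (A t) (x t)) (hx0 : ∀ i, 0 ≤ x t₀ i)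
    (hx1 : ∀ i, x t₀ i ≤ 1) {ε : ℝ} (hε : 0 < ε) {i j : Fin n} (hij : ε ≤ x t₀ i - x t₀ j) :
    ∃ t₁ ≥ t₀, energy (π t₁) (x t₁) + p * γ / (1 + γ) * (ε / n / 2) ^ 3 ≤
      energy (π t₀) (x t₀) := by
  classical
  have hn : (0 : ℝ) < n := Nat.cast_pos.2 i.pos
  obtain ⟨S, c, hi, hj, hSup, hSlow⟩ := exists_gap hε hij
  set δ := ε / n with hδdef
  have hδ : 0 < δ := by positivity
  set F : ℕ → ℝ := fun T => ∑ t ∈ Finset.Ico t₀ T, (cut (A t) S + cut (A t) Sᶜ) with hF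
  have hex : ∃ T, t₀ ≤ T ∧ δ / 2 ≤ F T :=
    ((Filter.eventually_ge_atTop t₀).and
      ((tendsto_cut_of_connected hA hconn hi hj t₀).eventually_ge_atTop (δ / 2))).exists
  obtain ⟨ht₁, hFt₁⟩ := Nat.find_spec hex
  have hmin : ∀ t, t₀ ≤ t → t < Nat.find hex → F t < δ / 2 := fun t ht ht' => by
    have := Nat.find_min hex ht'
    by_contra h
    exact this ⟨ht, not_lt.1 h⟩
  set t₁ := Nat.find hex
  refine ⟨t₁, ht₁, ?_⟩
  have hupper := fun t (ht : t₀ ≤ t) => le_of_forward hA hx (l := 0) (c := c + δ)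
    (fun t ht => le_forward hA hx hx0 ht) (by linarith [hSup i hi, hx1 i]) hSup ht
  have hlower := fun t (ht : t₀ ≤ t) => le_of_forward hA (x := fun t => -x t) (forward_neg hx)
    (l := -1) (c := -c) (S := Sᶜ)
    (fun t ht => le_forward hA (x := fun t => -x t) (forward_neg hx)
      (fun i => neg_le_neg (hx1 i)) ht) (by linarith [hSlow j hj, hx0 j])
    (fun k hk => neg_le_neg (hSlow k (Finset.mem_compl.1 hk))) ht
  have hgap : ∀ t, t₀ ≤ t → t < t₁ → ∀ k ∈ S, ∀ m ∉ S, δ / 2 ≤ x t k - x t m := by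
    intro t ht ht' k hk m hm
    have h1 := hupper t ht k hk
    have h2 := hlower t ht m (Finset.mem_compl.2 hm)
    have h3 := hmin t ht ht'
    simp only [hF, Finset.sum_add_distrib] at h3
    simp only [Pi.neg_apply] at h2
    linarith
  have hκ : 0 ≤ p * γ / (1 + γ) := by positivity
  have hsum := le_of_step_add (u := fun t => energy (π t) (x t))
    (h := fun t => p * γ / (1 + γ) * ((δ / 2) ^ 2 * (cut (A t) S + cut (A t) Sᶜ))) ht₁
    fun t ht ht' => by
      have h1 := energy_decrease (hA t) hγ (hdiag t) hp (hπp (t + 1)) (x t)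
      rw [hπ.2 t, ← hx t ht] at h1
      refine le_trans ?_ h1
      gcongr
      exact mul_cut_le_sum (hA t) (by positivity) (hgap t ht ht')
  refine le_trans ?_ hsum
  rw [← Finset.mul_sum, ← Finset.mul_sum]
  have h4 : (δ / 2) ^ 3 ≤ (δ / 2) ^ 2 * F t₁ := by
    rw [pow_succ]
    exact mul_le_mul_of_nonneg_left hFt₁ (by positivity)
  gcongr

/-- A forward trajectory has small spread at some time. -/
theorem exists_spread_lt {A : ℕ → Matrix (Fin n) (Fin n) ℝ} (hA : IsStochasticChain A)
    (hconn : (infiniteFlowGraph A).Connected) {γ p : ℝ} (hγ : 0 < γ) (hdiag : ∀ t i, γ ≤ A t i i)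
    (hp : 0 < p) {π : ℕ → Fin n → ℝ} (hπ : IsAbsoluteProbabilitySequence A π)
    (hπp : ∀ t i, p ≤ π t i) {x : ℕ → Fin n → ℝ} {t₀ : ℕ}
    (hx : ∀ t ≥ t₀, x (t + 1) = Matrix.mulVec (A t) (x t)) (hx0 : ∀ i, 0 ≤ x t₀ i)
    (hx1 : ∀ i, x t₀ i ≤ 1) {ε : ℝ} (hε : 0 < ε) :
    ∃ t ≥ t₀, ∀ i j, x t i - x t j < ε := by
  by_contra! h
  have hn : (0 : ℝ) < n := by
    obtain ⟨i, -⟩ := h t₀ le_rfl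
    exact Nat.cast_pos.2 i.pos
  set κ := p * γ / (1 + γ) * (ε / n / 2) ^ 3 with hκdef
  have hκ : 0 < κ := by positivity
  have hx1' : ∀ t ≥ t₀, ∀ i, x t i ≤ 1 := fun t ht i => by
    simpa using le_forward hA (x := fun t => -x t) (forward_neg hx)
      (fun i => neg_le_neg (hx1 i)) ht i
  have hdrop : ∀ k : ℕ, ∃ t ≥ t₀, energy (π t) (x t) + k * κ ≤ energy (π t₀) (x t₀) := by
    intro k
    induction k with
    | zero => exact ⟨t₀, le_rfl, by simp⟩
    | succ k ih =>
      obtain ⟨t, ht, hk⟩ := ih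
      obtain ⟨i, j, hij⟩ := h t ht
      obtain ⟨t₁, ht₁, hE⟩ := exists_energy_drop hA hconn hγ hdiag hp hπ hπp
        (fun s hs => hx s (ht.trans hs)) (le_forward hA hx hx0 ht) (hx1' t ht) hε hij
      refine ⟨t₁, ht.trans ht₁, ?_⟩
      rw [← hκdef] at hE
      push_cast
      linarith
  obtain ⟨k, hk⟩ := exists_nat_gt (energy (π t₀) (x t₀) / κ)
  rw [div_lt_iff₀ hκ] at hk
  obtain ⟨t, -, ht⟩ := hdrop k
  have : 0 ≤ energy (π t) (x t) :=
    Finset.sum_nonneg fun i _ => mul_nonneg ((hπ.1 t).1 i) (sq_nonneg _)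
  linarith

theorem dotProduct_forward {A : ℕ → Matrix (Fin n) (Fin n) ℝ} {π : ℕ → Fin n → ℝ}
    (hπ : IsAbsoluteProbabilitySequence A π) {x : ℕ → Fin n → ℝ} {t₀ : ℕ}
    (hx : ∀ t ≥ t₀, x (t + 1) = Matrix.mulVec (A t) (x t)) {t : ℕ} (ht : t₀ ≤ t) :
    π t ⬝ᵥ x t = π t₀ ⬝ᵥ x t₀ := by
  induction t, ht using Nat.le_induction with
  | base => rfl
  | succ t ht ih => rw [hx t ht, Matrix.dotProduct_mulVec, hπ.2, ih]

theorem dotProduct_sub_le {v w x : Fin n → ℝ} (hv : v ∈ stdSimplex ℝ (Fin n))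
    (hw : w ∈ stdSimplex ℝ (Fin n)) {ε : ℝ} (hx : ∀ i j, x i - x j < ε) :
    v ⬝ᵥ x - w ⬝ᵥ x ≤ ε := by
  have h1 : ∀ j, v ⬝ᵥ x ≤ x j + ε := fun j => by
    calc v ⬝ᵥ x ≤ ∑ i, v i * (x j + ε) :=
          Finset.sum_le_sum fun i _ => mul_le_mul_of_nonneg_left (by linarith [hx i j]) (hv.1 i)
      _ = x j + ε := by rw [← Finset.sum_mul, hv.2, one_mul]
  have h2 : v ⬝ᵥ x - ε ≤ w ⬝ᵥ x := by
    calc v ⬝ᵥ x - ε = ∑ j, w j * (v ⬝ᵥ x - ε) := by rw [← Finset.sum_mul, hw.2, one_mul]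
      _ ≤ w ⬝ᵥ x :=
          Finset.sum_le_sum fun j _ => mul_le_mul_of_nonneg_left (by linarith [h1 j]) (hw.1 j)
  linarith

theorem eq_of_connected {A : ℕ → Matrix (Fin n) (Fin n) ℝ} (hA : IsStochasticChain A)
    (hconn : (infiniteFlowGraph A).Connected) {γ p : ℝ} (hγ : 0 < γ) (hdiag : ∀ t i, γ ≤ A t i i)
    (hp : 0 < p) {π : ℕ → Fin n → ℝ} (hπ : IsAbsoluteProbabilitySequence A π)
    (hπp : ∀ t i, p ≤ π t i) {ρ : ℕ → Fin n → ℝ} (hρ : IsAbsoluteProbabilitySequence A ρ) :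
    ρ = π := by
  funext t₀ j
  -- the forward trajectory that starts at time `t₀` from the `j`-th unit vector
  let y : ℕ → Fin n → ℝ := fun k =>
    Nat.rec (Pi.single j 1) (fun k v => Matrix.mulVec (A (t₀ + k)) v) k
  let x : ℕ → Fin n → ℝ := fun t => y (t - t₀)
  have hx : ∀ t ≥ t₀, x (t + 1) = Matrix.mulVec (A t) (x t) := fun t ht => by
    obtain ⟨k, rfl⟩ := Nat.exists_eq_add_of_le ht
    have h1 : t₀ + k + 1 - t₀ = k + 1 := by omega
    have h2 : t₀ + k - t₀ = k := by omega
    simp only [x, h1, h2, y]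
  have hxt₀ : x t₀ = Pi.single j 1 := by simp [x, y]
  have hx0 : ∀ i, 0 ≤ x t₀ i := fun i => by
    rw [hxt₀, Pi.single_apply]; split_ifs <;> norm_num
  have hx1 : ∀ i, x t₀ i ≤ 1 := fun i => by
    rw [hxt₀, Pi.single_apply]; split_ifs <;> norm_num
  have hval : ∀ w : Fin n → ℝ, w ⬝ᵥ x t₀ = w j := fun w => by rw [hxt₀]; simp
  refine le_antisymm ?_ ?_ <;> refine le_of_forall_pos_le_add fun ε hε => ?_ <;>
    obtain ⟨t, ht, hspread⟩ := exists_spread_lt hA hconn hγ hdiag hp hπ hπp hx hx0 hx1 hε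
  · have := dotProduct_sub_le (hρ.1 t) (hπ.1 t) hspread
    rw [dotProduct_forward hρ hx ht, dotProduct_forward hπ hx ht, hval, hval] at this
    linarith
  · have := dotProduct_sub_le (hπ.1 t) (hρ.1 t) hspread
    rw [dotProduct_forward hρ hx ht, dotProduct_forward hπ hx ht, hval, hval] at this
    linarith

/-! ### Disconnected flow graphs -/

theorem summable_of_not_adj {A : ℕ → Matrix (Fin n) (Fin n) ℝ} (hA : IsStochasticChain A)
    {i j : Fin n} (hne : i ≠ j) (hadj : ¬ (infiniteFlowGraph A).Adj i j) :
    Summable fun t => A t i j + A t j i := by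
  have h0 : ∀ t, 0 ≤ A t i j + A t j i := fun t => add_nonneg ((hA t).1 i j) ((hA t).1 j i)
  by_contra h
  exact hadj ⟨hne, (not_summable_iff_tendsto_nat_atTop_of_nonneg h0).1 h⟩

theorem exists_summable_cut {A : ℕ → Matrix (Fin n) (Fin n) ℝ} (hA : IsStochasticChain A)
    (hn : 0 < n) (hconn : ¬ (infiniteFlowGraph A).Connected) :
    ∃ (S : Finset (Fin n)) (i j : Fin n), i ∈ S ∧ j ∉ S ∧
      Summable (fun t => cut (A t) S) ∧ Summable fun t => cut (A t) Sᶜ := by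
  classical
  have : Nonempty (Fin n) := ⟨⟨0, hn⟩⟩
  obtain ⟨i, j, hij⟩ : ∃ i j, ¬ (infiniteFlowGraph A).Reachable i j := by
    by_contra! h
    exact hconn ⟨h⟩
  set S := Finset.univ.filter fun k => (infiniteFlowGraph A).Reachable i k with hS
  have hmem : ∀ k, k ∈ S ↔ (infiniteFlowGraph A).Reachable i k := by simp [hS]
  have hpair : ∀ k ∈ S, ∀ m ∉ S, Summable (fun t => A t k m + A t m k) := by
    intro k hk m hm
    refine summable_of_not_adj hA (fun h => hm (h ▸ hk)) fun hadj => hm ?_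
    exact (hmem m).2 (((hmem k).1 hk).trans hadj.reachable)
  refine ⟨S, i, j, (hmem i).2 (SimpleGraph.Reachable.refl i), fun h => hij ((hmem j).1 h), ?_, ?_⟩
  · refine summable_sum fun k hk => summable_sum fun m hm => ?_
    exact (hpair k hk m (Finset.mem_compl.1 hm)).of_nonneg_of_le (fun t => (hA t).1 k m)
      fun t => le_add_of_nonneg_right ((hA t).1 m k)
  · simp only [cut, compl_compl]
    refine summable_sum fun m hm => summable_sum fun k hk => ?_
    exact (hpair k hk m (Finset.mem_compl.1 hm)).of_nonneg_of_le (fun t => (hA t).1 m k)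
      fun t => le_add_of_nonneg_left ((hA t).1 k m)

/-- If the total flow out of `S` is finite, then from some time on some absolute probability
sequence is concentrated on `S` up to `1/4`. -/
theorem exists_concentrated {A : ℕ → Matrix (Fin n) (Fin n) ℝ} (hA : IsStochasticChain A)
    {S : Finset (Fin n)} {i : Fin n} (hi : i ∈ S) (hS : Summable fun t => cut (A t) S) :
    ∃ π, IsAbsoluteProbabilitySequence A π ∧
      ∀ᶠ t in Filter.atTop, 3 / 4 ≤ ∑ k ∈ S, π t k := by
  have hsmall : ∃ t₀, ∀ t ≥ t₀, ∑' k, cut (A (k + t)) S < 1 / 4 :=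
    Filter.eventually_atTop.1 ((tendsto_sum_nat_add fun t => cut (A t) S).eventually_lt_const
      (by norm_num))
  obtain ⟨t₀, ht₀⟩ := hsmall
  choose q hq hqT using exists_isBackwardTrajectory hA (single_mem_stdSimplex ℝ i)
  obtain ⟨π, hπ, hπC⟩ := exists_absoluteProbabilitySequence hq
    (C := fun t => {w | t₀ ≤ t → 3 / 4 ≤ ∑ k ∈ S, w k}) (fun t => by
      by_cases h : t₀ ≤ t
      · simp only [h, forall_const]
        exact isClosed_le continuous_const
          (continuous_finsetSum _ fun k _ => continuous_apply k)
      · simp [h]) fun T t ht ht₀t => by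
    have hstep := le_of_step_add (u := fun s => ∑ k ∈ S, q T s k)
      (h := fun s => -cut (A s) S) ht fun s _ hsT => by
        have h1 := le_sum_vecMul (hA s) ((hq T).1 (s + 1)).1 S (e := 0)
          fun k _ => ((hq T).1 (s + 1)).1 k
        rw [(hq T).2 s hsT] at h1
        have h2 : ∑ k ∈ S, q T (s + 1) k ≤ 1 := by
          rw [← ((hq T).1 (s + 1)).2]
          exact Finset.sum_le_sum_of_subset_of_nonneg (Finset.subset_univ _)
            fun k _ _ => ((hq T).1 (s + 1)).1 k
        have h3 := mul_le_mul_of_nonneg_left h2 (cut_nonneg (hA s) S)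
        linarith
    have hstart : ∑ k ∈ S, q T T k = 1 := by
      rw [hqT, Finset.sum_pi_single', if_pos hi]
    have htail : ∑ s ∈ Finset.Ico t T, cut (A s) S ≤ ∑' k, cut (A (k + t)) S := by
      rw [Finset.sum_Ico_eq_sum_range]
      simp only [add_comm t]
      exact ((summable_nat_add_iff t).2 hS).sum_le_tsum _ fun k _ => cut_nonneg (hA _) S
    rw [Finset.sum_neg_distrib, hstart] at hstep
    linarith [ht₀ t ht₀t]
  exact ⟨π, hπ, Filter.eventually_atTop.2 ⟨t₀, fun t ht => hπC t ht⟩⟩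

end StochasticChain

open StochasticChain in
theorem theorem2 {n : ℕ} (A : ℕ → Matrix (Fin n) (Fin n) ℝ)
    (hA : StochasticChain.IsStochasticChain A)
    (haper : StochasticChain.StronglyAperiodic A)
    (hrec : StochasticChain.ApproxReciprocal A) :
    (∃! π : ℕ → Fin n → ℝ, StochasticChain.IsAbsoluteProbabilitySequence A π) ↔
      (StochasticChain.infiniteFlowGraph A).Connected := by
  constructor
  · rintro ⟨π, hπ, huniq⟩
    have hn : 0 < n := by
      -- for `n = 0` there is no vector with entries summing to `1`
      rcases Nat.eq_zero_or_pos n with rfl | h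
      · simpa using (hπ.1 0).2
      · exact h
    by_contra hconn
    obtain ⟨S, i, j, hi, hj, hS, hSc⟩ := exists_summable_cut hA hn hconn
    obtain ⟨ρ, hρ, hρS⟩ := exists_concentrated hA hi hS
    obtain ⟨σ, hσ, hσS⟩ := exists_concentrated hA (Finset.mem_compl.2 hj) hSc
    obtain ⟨t, ht1, ht2⟩ := (hρS.and hσS).exists
    rw [huniq ρ hρ] at ht1
    rw [huniq σ hσ] at ht2
    have hsum := (hπ.1 t).2
    rw [← Finset.sum_add_sum_compl S] at hsum
    linarith
  · intro hconn
    have hn : 0 < n := hconn.nonempty.elim fun i => i.pos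
    obtain ⟨p, hp, π, hπ, hπp⟩ := exists_absoluteProbabilitySequence_pos hn hA haper hrec
    obtain ⟨γ, hγ, hdiag⟩ := haper
    exact ⟨π, hπ, fun ρ hρ => eq_of_connected hA hconn hγ hdiag hp hπ hπp hρ⟩
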